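/- **Definitions.** A configuration is a map $c\colon\mathbb Z^2\to\{0,1\}$. For a finite set $D\subseteq\mathbb Z^2$ and non-negative integers $b,a$, a configuration $c$ is a *$(D,b,a)$-covering* if for every $\vec u\in\mathbb Z^2$ the number of cells of colour $1$ in $\vec u+D$ is exactly $b$ if $c(\vec u)=1$ and exactly $a$ if $c(\vec u)=0$. Let $\mathcal S(D,b,a)\subseteq\{0,1\}^{\mathbb Z^2}$ be the set of all $(D,b,a)$-coverings. Let $f_D=\sum_{\vec u\in D}X^{-\vec u}$, where $X^{(u_1,u_2)}=x^{u_1}y^{u_2}$. A *line polynomial* is a Laurent polynomial whose support contains at least two points and is contained in a line; $f$ *has no line polynomial factors* if no line polynomial in $\mathbb C[x^{\pm1},y^{\pm1}]$ divides $f$ in $\mathbb C[x^{\pm1},y^{\pm1}]$. A *subshift of finite type* (SFT) is the set of all configurations in which no pattern of some finite set of finite patterns appears. **Theorem.** Let $D\subseteq\mathbb Z^2$ be finite and let $b,a$ be non-negative integers such that the Laurent polynomial $g=f_D-(b-a)$ has no line polynomial factors. Then $\mathcal S(D,b,a)$ is an SFT and it is finite. Moreover, one can effectively construct all of its elements: there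 is a single algorithm (a partial recursive function) which, on every input $(D,b,a)$ such that $g$ has no line polynomial factors, with $D$ given as a finite list of points, halts and outputs a finite list of pairs $(N,w)$ with $N\ge 1$ and $w=(w_0,\dots,w_{N^2-1})\in\{0,1\}^{N^2}$, such that $\mathcal S(D,b,a)$ is exactly the set of the configurations $$c_{N,w}(i,j)=w_{(i\bmod N)\,N+(j\bmod N)}\qquad((i,j)\in\mathbb Z^2)$$ for the pairs $(N,w)$ in the list. -/

import Mathlib

/-- The grid `ℤ²`. -/
abbrev Grid : Type := ℤ × ℤ

/-- Two-dimensional configurations over the alphabet `A`. -/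
abbrev Config (A : Type) : Type := Grid → A

/-- The translation by `t`: the symbol of `c` in cell `u - t` is moved to cell `u`. -/
def translateConfig {A : Type} (t : Grid) (c : Config A) : Config A := fun u => c (u - t)

/-- Finite patterns over `A`: a finite shape together with an assignment of symbols to it. -/
abbrev Pattern (A : Type) : Type := Σ E : Finset Grid, ({u : Grid // u ∈ E} → A)

/-- The pattern `p` appears in the configuration `c`: some translate of `c`, restricted to the
shape of `p`, is `p`. -/
def Appears {A : Type} (p : Pattern A) (c : Config A) : Prop :=
  ∃ t : Grid, ∀ u : {u : Grid // u ∈ p.1}, translateConfig t c u.1 = p.2 u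

/-- The subshift of all configurations that avoid the patterns in `F`. -/
def subshift {A : Type} (F : Set (Pattern A)) : Set (Config A) :=
  {c | ∀ p : Pattern A, Appears p c → p ∉ F}

/-- Subshifts of finite type: those given by a finite set of forbidden patterns. -/
def IsSFT {A : Type} (S : Set (Config A)) : Prop :=
  ∃ F : Set (Pattern A), F.Finite ∧ S = subshift F

/-- The set `𝒮(D, b, a)` of all `(D, b, a)`-coverings: the binary configurations in which the
neighbourhood `u + D` of any cell `u` contains exactly `b` cells of colour `1` if `u` has
colour `1`, and exactly `a` cells of colour `1` if `u` has colour `0`. -/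
def coverings (D : Finset Grid) (b a : ℕ) : Set (Config (Fin 2)) :=
  {c | ∀ u : Grid, (D.filter (fun v => c (u + v) = 1)).card = if c u = 1 then b else a}

/-- Laurent polynomials in two variables with complex coefficients; the monomial
`X ^ u = x ^ u₁ * y ^ u₂` is `AddMonoidAlgebra.single u 1`. -/
abbrev Laurent : Type := AddMonoidAlgebra ℂ Grid

/-- The characteristic polynomial `f_D = ∑_{u ∈ D} X ^ (-u)` of a finite shape. -/
noncomputable def charPolynomial (D : Finset Grid) : Laurent :=
  ∑ u ∈ D, AddMonoidAlgebra.single (-u) 1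

/-- The polynomial `f_D - (b - a)`. -/
noncomputable def coveringPolynomial (D : Finset Grid) (b a : ℕ) : Laurent :=
  charPolynomial D - AddMonoidAlgebra.single 0 ((b : ℂ) - (a : ℂ))

/-- A line polynomial: the support has at least two points and lies on a line `u + ℚ v`. -/
def IsLinePolynomial (f : Laurent) : Prop :=
  (∃ w : Grid, ∃ w' : Grid, w ≠ w' ∧ f.coeff w ≠ 0 ∧ f.coeff w' ≠ 0) ∧
  ∃ u v : Grid, ∀ w : Grid, f.coeff w ≠ 0 →
    ∃ q : ℚ, (w.1 : ℚ) = u.1 + q * v.1 ∧ (w.2 : ℚ) = u.2 + q * v.2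

/-- The polynomial has a line polynomial factor in the ring of Laurent polynomials. -/
def HasLinePolynomialFactor (f : Laurent) : Prop :=
  ∃ φ : Laurent, IsLinePolynomial φ ∧ φ ∣ f

/-- Finite descriptions of two-periodic binary configurations: a side length `N` and the list of
the `N * N` colours in a fundamental square, row by row. -/
abbrev TorusCode : Type := ℕ × List (Fin 2)

/-- The side length is positive and the list has the right length. -/
def TorusCode.Valid (d : TorusCode) : Prop := 0 < d.1 ∧ d.2.length = d.1 * d.1

/-- The configuration with periods `(N, 0)` and `(0, N)` that has, in the cell `(i, j)` with
`0 ≤ i, j < N`, the colour in position `i * N + j` of the list. For valid codes the default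
value of `getD` is never used. -/
def TorusCode.toConfig (d : TorusCode) : Config (Fin 2) := fun u =>
  d.2.getD ((u.1 % (d.1 : ℤ)).toNat * d.1 + (u.2 % (d.1 : ℤ)).toNat) 0

/-! Write g = f_D - (b - a). A covering c satisfies g c = a, a constant, so g lies in the ideal of
Laurent polynomials sending c to a constant configuration (`constIdeal`). The aim is to find in this
ideal, for every direction e, a monic polynomial in X^e of degree bounded in terms of the input
alone.

Modulo a prime p, Frobenius turns g(X^n)^p into g(X^(pn)). Since c is binary, a value constant
modulo a large p is constant, so all dilations g(X^n) with n free of small primes lie in the ideal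
(`dilatedSum_const`). Taking n = 1 + jM with M = K!, a Vandermonde-type elimination yields a product
of binomials X^(M u₀) - X^(M u) in the ideal (`binomialProduct_mem`).

Each binomial is, up to a unit, a product of factors X^v - ζ with v primitive. Modulo such a factor
g becomes a polynomial in one monomial, nonzero because g has no line polynomial factors; splitting
it over ℂ gives a product of terms X^e - r in the ideal (`splitElim_mon_sub_of_primitive`).

Hence along any direction the colours of c obey a recurrence of bounded order. By pigeonhole all
coverings share an explicit period N, so there are finitely many, and testing all N × N squares
lists them (`coverings_periodic`, `coverings_eq_coveringCodes`). -/

/-! ### Monomials and congruences modulo binomials. -/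

/-- The monomial `X ^ u`. -/
noncomputable def mon (k : Type) [CommRing k] (u : Grid) : AddMonoidAlgebra k Grid :=
  AddMonoidAlgebra.single u 1

section Monomials

variable {k : Type} [CommRing k]

theorem mon_zero : mon k 0 = 1 := rfl

theorem mon_add (u v : Grid) : mon k (u + v) = mon k u * mon k v := by
  simp [mon, AddMonoidAlgebra.single_mul_single]

theorem mon_nsmul (n : ℕ) (u : Grid) : mon k (n • u) = mon k u ^ n := by
  induction n with
  | zero => simp [mon_zero]
  | succ n ih => rw [succ_nsmul, mon_add, ih, pow_succ]

theorem mon_mul_mon_neg (u : Grid) : mon k u * mon k (-u) = 1 := by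
  rw [← mon_add, add_neg_cancel, mon_zero]

theorem isUnit_mon (u : Grid) : IsUnit (mon k u) :=
  IsUnit.of_mul_eq_one _ (mon_mul_mon_neg u)

theorem single_eq_algebraMap_mul_mon (u : Grid) (a : k) :
    AddMonoidAlgebra.single u a = algebraMap k _ a * mon k u := by
  simp [mon, AddMonoidAlgebra.single_mul_single]

theorem sum_algebraMap_mul_mon (g : AddMonoidAlgebra k Grid) :
    ∑ u ∈ g.coeff.support, algebraMap k _ (g.coeff u) * mon k u = g := by
  conv_rhs => rw [← AddMonoidAlgebra.sum_coeff_single g]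
  simp only [← single_eq_algebraMap_mul_mon]
  rfl

end Monomials

theorem mon_sub_dvd_mon_zsmul_sub (v : Grid) {ζ : ℂ} (hζ : ζ ≠ 0) (n : ℤ) :
    mon ℂ v - algebraMap ℂ _ ζ ∣ mon ℂ (n • v) - algebraMap ℂ _ (ζ ^ n) := by
  obtain ⟨n, rfl | rfl⟩ := n.eq_nat_or_neg
  · rw [natCast_zsmul, mon_nsmul, zpow_natCast, map_pow]
    exact sub_dvd_pow_sub_pow _ _ n
  · have h : mon ℂ ((-(n : ℤ)) • v) - algebraMap ℂ _ (ζ ^ (-(n : ℤ))) =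
        (mon ℂ v ^ n - algebraMap ℂ Laurent ζ ^ n) *
          (-(mon ℂ (-(n • v)) * algebraMap ℂ Laurent (ζ ^ n)⁻¹)) := by
      have h1 : mon ℂ v ^ n * mon ℂ (-(n • v)) = 1 := by
        rw [← mon_nsmul, mon_mul_mon_neg]
      have h2 : algebraMap ℂ Laurent ζ ^ n * algebraMap ℂ Laurent (ζ ^ n)⁻¹ = 1 := by
        rw [← map_pow, ← map_mul, mul_inv_cancel₀ (pow_ne_zero _ hζ), map_one]
      rw [neg_smul, natCast_zsmul, zpow_neg, zpow_natCast]
      linear_combination (algebraMap ℂ Laurent (ζ ^ n)⁻¹) * h1 - mon ℂ (-(n • v)) * h2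
    rw [h]
    exact (sub_dvd_pow_sub_pow _ _ n).mul_right _

theorem exists_mon_sub_dvd_mon_zsmul_sub (w : Grid) (r : ℂ) (n : ℤ) :
    ∃ ρ : ℂ, mon ℂ w - algebraMap ℂ _ r ∣ mon ℂ (n • w) - algebraMap ℂ _ ρ := by
  by_cases hr : r = 0
  -- For r = 0 the divisor is a unit, so negative n causes no trouble.
  · refine ⟨0, ?_⟩
    rw [hr, map_zero, sub_zero]
    exact (isUnit_mon w).dvd
  · exact ⟨r ^ n, mon_sub_dvd_mon_zsmul_sub w hr n⟩

/-- Modulo `X ^ v - ζ` with `v` primitive, every monomial is a multiple of a power of one fixed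
monomial. -/
theorem mon_sub_dvd_mon_sub {p q r s : ℤ} (h : r * p + s * q = 1) {ζ : ℂ} (hζ : ζ ≠ 0)
    (u : Grid) :
    mon ℂ (p, q) - algebraMap ℂ _ ζ ∣ mon ℂ u -
      algebraMap ℂ _ (ζ ^ (r * u.1 + s * u.2)) * mon ℂ ((p * u.2 - q * u.1) • (-s, r)) := by
  have hu : u = (r * u.1 + s * u.2) • ((p, q) : Grid) + (p * u.2 - q * u.1) • ((-s, r) : Grid) := by
    ext
    · simp only [Prod.fst_add, Prod.smul_fst, smul_eq_mul]
      linear_combination (-u.1) * h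
    · simp only [Prod.snd_add, Prod.smul_snd, smul_eq_mul]
      linear_combination (-u.2) * h
  conv_rhs => rw [show mon ℂ u = _ from congrArg (mon ℂ) hu, mon_add, ← sub_mul]
  exact (mon_sub_dvd_mon_zsmul_sub _ hζ _).mul_right _

/-- Modulo X^(p,q) - ζ, g is a Laurent polynomial in X^(-s,r) with exponents in [-m, m]; shifting by
m removes the negative ones. -/
theorem exists_polynomial_dvd_sub {p q r s : ℤ} (h : r * p + s * q = 1) {ζ : ℂ} (hζ : ζ ≠ 0)
    (g : Laurent) (m : ℕ) (hm : ∀ u ∈ g.coeff.support, |p * u.2 - q * u.1| ≤ m) :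
    ∃ P : Polynomial ℂ, P.natDegree ≤ 2 * m ∧
      mon ℂ (p, q) - algebraMap ℂ _ ζ ∣
        mon ℂ (m • (-s, r)) * g - Polynomial.aeval (mon ℂ (-s, r)) P := by
  refine ⟨∑ u ∈ g.coeff.support, Polynomial.monomial (p * u.2 - q * u.1 + m).toNat
    (g.coeff u * ζ ^ (r * u.1 + s * u.2)), ?_, ?_⟩
  · refine Polynomial.natDegree_sum_le_of_forall_le _ _ fun u hu => ?_
    refine (Polynomial.natDegree_monomial_le _).trans ?_
    have := abs_le.1 (hm u hu)
    omega
  · have hg : mon ℂ (m • ((-s, r) : Grid)) * g = ∑ u ∈ g.coeff.support,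
        mon ℂ (m • ((-s, r) : Grid)) * (algebraMap ℂ Laurent (g.coeff u) * mon ℂ u) := by
      rw [← Finset.mul_sum, sum_algebraMap_mul_mon]
    rw [hg, map_sum, ← Finset.sum_sub_distrib]
    refine Finset.dvd_sum fun u hu => ?_
    have hu' := abs_le.1 (hm u hu)
    have h1 : mon ℂ (m • ((-s, r) : Grid)) * mon ℂ ((p * u.2 - q * u.1) • (-s, r)) =
        mon ℂ ((-s, r) : Grid) ^ (p * u.2 - q * u.1 + m).toNat := by
      rw [← mon_nsmul, ← mon_add]
      congr 1
      rw [← natCast_zsmul, ← natCast_zsmul, ← add_zsmul, Int.toNat_of_nonneg (by omega), add_comm]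
    obtain ⟨t, ht⟩ := mon_sub_dvd_mon_sub h hζ u
    refine ⟨mon ℂ (m • (-s, r)) * algebraMap ℂ _ (g.coeff u) * t, ?_⟩
    rw [Polynomial.aeval_monomial, map_mul, ← h1]
    linear_combination (mon ℂ (m • ((-s, r) : Grid)) * algebraMap ℂ Laurent (g.coeff u)) * ht

/-! ### Elimination of one variable. -/

/-- The ideal generated by `g` and `f` contains a split polynomial of degree at most `d` in the
monomial `X ^ e`. -/
def SplitElim (e : Grid) (d : ℕ) (g f : Laurent) : Prop :=
  ∃ s : Multiset ℂ, s.card ≤ d ∧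
    (s.map fun r => mon ℂ e - algebraMap ℂ Laurent r).prod ∈ Ideal.span {g, f}

theorem SplitElim.mono {e : Grid} {d d' : ℕ} {g f : Laurent} (h : SplitElim e d g f)
    (hd : d ≤ d') : SplitElim e d' g f :=
  let ⟨s, hs, hm⟩ := h
  ⟨s, hs.trans hd, hm⟩

theorem SplitElim.of_dvd {e : Grid} {d : ℕ} {g f f' : Laurent} (h : SplitElim e d g f)
    (hf : f' ∣ f) : SplitElim e d g f' := by
  obtain ⟨s, hs, hm⟩ := h
  refine ⟨s, hs, Ideal.span_le.2 ?_ hm⟩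
  rintro x (rfl | rfl)
  · exact Ideal.subset_span (by simp)
  · exact Ideal.mem_of_dvd _ hf (Ideal.subset_span (by simp))

theorem splitElim_one (e : Grid) (g : Laurent) : SplitElim e 0 g 1 :=
  ⟨0, le_rfl, by simpa using Ideal.subset_span (by simp)⟩

/-- In (x g + y f)(x' g + y' f') the only term not a multiple of g is y y' f f'. -/
theorem SplitElim.mul {e : Grid} {d d' : ℕ} {g f f' : Laurent} (h : SplitElim e d g f)
    (h' : SplitElim e d' g f') : SplitElim e (d + d') g (f * f') := by
  obtain ⟨s, hs, hm⟩ := h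
  obtain ⟨s', hs', hm'⟩ := h'
  refine ⟨s + s', by rw [Multiset.card_add]; omega, ?_⟩
  rw [Multiset.map_add, Multiset.prod_add]
  obtain ⟨x, y, hxy⟩ := Ideal.mem_span_pair.1 hm
  obtain ⟨x', y', hxy'⟩ := Ideal.mem_span_pair.1 hm'
  rw [← hxy, ← hxy']
  exact Ideal.mem_span_pair.2 ⟨x * (x' * g + y' * f') + y * f * x', y * y', by ring⟩

theorem SplitElim.prod {ι : Type*} {e : Grid} {d : ℕ} {g : Laurent} (I : Finset ι)
    (f : ι → Laurent) (h : ∀ i ∈ I, SplitElim e d g (f i)) :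
    SplitElim e (I.card * d) g (∏ i ∈ I, f i) := by
  classical
  induction I using Finset.induction_on with
  | empty => simpa using splitElim_one e g
  | insert i I hi ih =>
    rw [Finset.prod_insert hi, Finset.card_insert_of_notMem hi, add_mul, one_mul, add_comm]
    exact (h i (by simp)).mul (ih fun j hj => h j (by simp [hj]))

theorem isLinePolynomial_mon_sub {v : Grid} (hv : v ≠ 0) {ζ : ℂ} (hζ : ζ ≠ 0) :
    IsLinePolynomial (mon ℂ v - algebraMap ℂ _ ζ) := by
  have hc : ∀ w, (mon ℂ v - algebraMap ℂ Laurent ζ).coeff w =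
      (if v = w then 1 else 0) - (if 0 = w then ζ else 0) := fun w => by
    simp [mon, Finsupp.single_apply]
  refine ⟨⟨v, 0, hv, ?_, ?_⟩, 0, v, fun w hw => ?_⟩
  · rw [hc, if_pos rfl, if_neg hv.symm]; simp
  · rw [hc, if_neg hv, if_pos rfl]; simpa using hζ
  · rw [hc] at hw
    by_cases h1 : v = w
    · exact ⟨1, by simp [h1]⟩
    · by_cases h2 : 0 = w
      · exact ⟨0, by simp [← h2]⟩
      · simp [h1, h2] at hw

theorem splitElim_mon_sub_of_primitive {p q r s : ℤ} (h : r * p + s * q = 1) {ζ : ℂ}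
    (hζ : ζ ≠ 0) {g : Laurent} (hg : ¬ HasLinePolynomialFactor g) (e : Grid) (m : ℕ)
    (hm : ∀ u ∈ g.coeff.support, |p * u.2 - q * u.1| ≤ m) :
    SplitElim e (2 * m) g (mon ℂ (p, q) - algebraMap ℂ _ ζ) := by
  obtain ⟨P, hP, hdvd⟩ := exists_polynomial_dvd_sub h hζ g m hm
  have hv : ((p, q) : Grid) ≠ 0 := by
    rintro h0
    obtain ⟨rfl, rfl⟩ := Prod.mk.inj h0
    simp at h
  -- If P vanished, the line polynomial X^(p,q) - ζ would divide a unit times g.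
  have hP0 : P ≠ 0 := by
    rintro rfl
    refine hg ⟨_, isLinePolynomial_mon_sub hv hζ, ?_⟩
    rw [map_zero, sub_zero] at hdvd
    exact ((isUnit_mon _).dvd_mul_left).1 hdvd
  have hsplit : P = Polynomial.C P.leadingCoeff * (P.roots.map fun a => Polynomial.X - Polynomial.C a).prod :=
    (IsAlgClosed.splits P).eq_prod_roots
  have hroots : ((P.roots.map fun a => mon ℂ (-s, r) - algebraMap ℂ Laurent a).prod) ∈
      Ideal.span {g, mon ℂ (p, q) - algebraMap ℂ _ ζ} := by
    have h1 : algebraMap ℂ Laurent P.leadingCoeff *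
        (P.roots.map fun a => mon ℂ (-s, r) - algebraMap ℂ Laurent a).prod =
        Polynomial.aeval (mon ℂ (-s, r)) P := by
      conv_rhs => rw [hsplit, map_mul, Polynomial.aeval_C, map_multiset_prod, Multiset.map_map]
      simp
    have h2 : (P.roots.map fun a => mon ℂ (-s, r) - algebraMap ℂ Laurent a).prod =
        algebraMap ℂ Laurent P.leadingCoeff⁻¹ * Polynomial.aeval (mon ℂ (-s, r)) P := by
      rw [← h1, ← mul_assoc, ← map_mul, inv_mul_cancel₀ (by simpa using hP0), map_one, one_mul]
    rw [h2]
    refine Ideal.mul_mem_left _ _ ?_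
    obtain ⟨t, ht⟩ := hdvd
    exact Ideal.mem_span_pair.2 ⟨mon ℂ (m • (-s, r)), -t, by linear_combination ht⟩
  -- Each factor X^(-s,r) - a is traded for one in X^e: modulo X^(p,q) - ζ, X^e is z times a power
  -- of X^(-s,r), and that power is a constant ρ modulo X^(-s,r) - a.
  have key : ∀ S : Multiset ℂ, ∃ S' : Multiset ℂ, S'.card = S.card ∧ ∃ A B : Laurent,
      (S'.map fun r => mon ℂ e - algebraMap ℂ Laurent r).prod =
        A * (S.map fun a => mon ℂ (-s, r) - algebraMap ℂ Laurent a).prod +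
        B * (mon ℂ (p, q) - algebraMap ℂ _ ζ) := by
    intro S
    induction S using Multiset.induction_on with
    | empty => exact ⟨0, rfl, 1, 0, by simp⟩
    | cons a S ih =>
      obtain ⟨S', hS', A, B, hAB⟩ := ih
      obtain ⟨ρ, t, ht⟩ := exists_mon_sub_dvd_mon_zsmul_sub (-s, r) a (p * e.2 - q * e.1)
      obtain ⟨t', ht'⟩ := mon_sub_dvd_mon_sub h hζ e
      set z := ζ ^ (r * e.1 + s * e.2)
      refine ⟨(z * ρ) ::ₘ S', by simp [hS'], algebraMap ℂ _ z * t * A,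
        t' * (A * (S.map fun a => mon ℂ (-s, r) - algebraMap ℂ Laurent a).prod +
        B * (mon ℂ (p, q) - algebraMap ℂ _ ζ)) +
          algebraMap ℂ _ z * (mon ℂ (-s, r) - algebraMap ℂ _ a) * t * B, ?_⟩
      rw [Multiset.map_cons, Multiset.prod_cons, Multiset.map_cons, Multiset.prod_cons, hAB,
        map_mul]
      have : mon ℂ e - algebraMap ℂ Laurent z * algebraMap ℂ Laurent ρ =
          (mon ℂ (p, q) - algebraMap ℂ _ ζ) * t' +
          algebraMap ℂ Laurent z * ((mon ℂ (-s, r) - algebraMap ℂ Laurent a) * t) := by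
        rw [← ht, ← ht']; ring
      rw [this]
      ring
  obtain ⟨S', hS', A, B, hAB⟩ := key P.roots
  refine ⟨S', ?_, ?_⟩
  · rw [hS']
    exact (P.card_roots').trans hP
  · rw [hAB]
    exact Ideal.add_mem _ (Ideal.mul_mem_left _ _ hroots)
      (Ideal.mul_mem_left _ _ (Ideal.subset_span (by simp)))

/-- With n the gcd of the coordinates of v, X^v - 1 is the product of X^(v/n) - ζ over the n-th
roots of unity, and n ≤ V. -/
theorem splitElim_mon_sub_one {g : Laurent} (hg : ¬ HasLinePolynomialFactor g) (e : Grid)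
    {K V : ℕ} (hK : ∀ u ∈ g.coeff.support, |u.1| ≤ K ∧ |u.2| ≤ K) {v : Grid} (hv : v ≠ 0)
    (hV : |v.1| ≤ V ∧ |v.2| ≤ V) :
    SplitElim e (V * (2 * (2 * V * K))) g (mon ℂ v - 1) := by
  obtain ⟨v1, v2⟩ := v
  have hn : 0 < Int.gcd v1 v2 := by
    rw [Int.gcd_pos_iff]
    by_contra! h
    exact hv (Prod.ext h.1 h.2)
  obtain ⟨p, q, hpq, hp, hq⟩ := Int.exists_gcd_one hn
  set n := Int.gcd v1 v2
  have hbez : Int.gcdA p q * p + Int.gcdB p q * q = 1 := by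
    have := Int.gcd_eq_gcd_ab p q
    rw [hpq] at this
    push_cast at this
    linarith
  have hn1 : (1 : ℤ) ≤ n := by exact_mod_cast hn
  dsimp only at hV
  have hp' : |p| ≤ V := by
    refine le_trans ?_ hV.1
    rw [hp, abs_mul, Nat.abs_cast]
    exact le_mul_of_one_le_right (abs_nonneg _) hn1
  have hq' : |q| ≤ V := by
    refine le_trans ?_ hV.2
    rw [hq, abs_mul, Nat.abs_cast]
    exact le_mul_of_one_le_right (abs_nonneg _) hn1
  have hnV : n ≤ V := by
    have h1 : (n : ℤ) * |p| ≤ V := by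
      have := hV.1; rw [hp, abs_mul, Nat.abs_cast] at this; linarith
    have h2 : (n : ℤ) * |q| ≤ V := by
      have := hV.2; rw [hq, abs_mul, Nat.abs_cast] at this; linarith
    have h3 : 1 ≤ |p| ∨ 1 ≤ |q| := by
      by_contra! h
      have hp0 : p = 0 := by have := abs_nonneg p; exact abs_eq_zero.1 (by omega)
      have hq0 : q = 0 := by have := abs_nonneg q; exact abs_eq_zero.1 (by omega)
      simp [hp0, hq0] at hbez
    zify
    rcases h3 with h3 | h3 <;> nlinarith
  have hfac : mon ℂ (v1, v2) - 1 =
      ∏ ζ ∈ Polynomial.nthRootsFinset n (1 : ℂ), (mon ℂ (p, q) - algebraMap ℂ Laurent ζ) := by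
    have h1 := congrArg (Polynomial.aeval (mon ℂ (p, q)))
      (Polynomial.X_pow_sub_one_eq_prod hn (Complex.isPrimitiveRoot_exp n hn.ne'))
    simp only [map_sub, map_pow, Polynomial.aeval_X, map_one, map_prod, Polynomial.aeval_C] at h1
    rw [← h1, ← mon_nsmul]
    congr 2
    ext
    · simp [hp, mul_comm]
    · simp [hq, mul_comm]
  rw [hfac]
  have hcard : (Polynomial.nthRootsFinset n (1 : ℂ)).card ≤ V := by
    rw [(Complex.isPrimitiveRoot_exp n hn.ne').card_nthRootsFinset]
    exact hnV
  refine (SplitElim.prod _ _ fun ζ hζ => ?_).mono (Nat.mul_le_mul_right _ hcard)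
  have hζ0 : ζ ≠ 0 := by
    rintro rfl
    rw [Polynomial.mem_nthRootsFinset hn, zero_pow hn.ne'] at hζ
    exact zero_ne_one hζ
  refine splitElim_mon_sub_of_primitive hbez hζ0 hg e _ fun u hu => ?_
  obtain ⟨h1, h2⟩ := hK u hu
  calc |p * u.2 - q * u.1| ≤ |p * u.2| + |q * u.1| := abs_sub _ _
    _ = |p| * |u.2| + |q| * |u.1| := by rw [abs_mul, abs_mul]
    _ ≤ V * K + V * K := by gcongr
    _ = ((2 * V * K : ℕ) : ℤ) := by push_cast; ring

/-- The product of the binomials `X ^ (M u₀) - X ^ (M u)` over the other points `u` of the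
support. -/
noncomputable def binomialProduct (g : Laurent) (u₀ : Grid) (M : ℕ) : Laurent :=
  ∏ u ∈ g.coeff.support.erase u₀, (mon ℂ (M • u₀) - mon ℂ (M • u))

theorem splitElim_binomialProduct {g : Laurent} (hg : ¬ HasLinePolynomialFactor g) (e : Grid)
    {K M : ℕ} (hM : M ≠ 0) (hK : ∀ u ∈ g.coeff.support, |u.1| ≤ K ∧ |u.2| ≤ K) {u₀ : Grid}
    (hu₀ : u₀ ∈ g.coeff.support) (hcard : (g.coeff.support.erase u₀).card ≤ K) :
    SplitElim e (K * (2 * M * K * (2 * (2 * (2 * M * K) * K)))) g (binomialProduct g u₀ M) := by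
  refine (SplitElim.prod _ _ fun u hu => ?_).mono (Nat.mul_le_mul_right _ hcard)
  have h1 : mon ℂ (M • u₀) - mon ℂ (M • u) ∣ mon ℂ (M • (u₀ - u)) - 1 := by
    refine ⟨mon ℂ (-(M • u)), ?_⟩
    rw [sub_mul, mon_mul_mon_neg, ← mon_add, ← sub_eq_add_neg, smul_sub]
  refine SplitElim.of_dvd (splitElim_mon_sub_one hg e hK ?_ ?_) h1
  · exact smul_ne_zero hM (sub_ne_zero.2 (Finset.ne_of_mem_erase hu).symm)
  · obtain ⟨a1, a2⟩ := hK _ hu₀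
    obtain ⟨b1, b2⟩ := hK _ (Finset.mem_of_mem_erase hu)
    have hbound : ∀ x y : ℤ, |x| ≤ K → |y| ≤ K → |(M : ℤ) * (x - y)| ≤ (2 * M * K : ℕ) := by
      intro x y hx hy
      rw [abs_mul, Nat.abs_cast]
      have := (abs_sub x y).trans (add_le_add hx hy)
      push_cast
      nlinarith
    constructor
    · simpa using hbound _ _ a1 b1
    · simpa using hbound _ _ a2 b2

/-! ### Laurent polynomials acting on configurations. -/

section Action

variable (k : Type) [CommRing k]

/-- The translations of `k`-valued configurations, as a representation of the grid. -/
def translationHom : Multiplicative Grid →* Module.End k (Grid → k) where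
  toFun u := LinearMap.funLeft k k fun w => w - u.toAdd
  map_one' := by ext; simp
  map_mul' u v := by
    refine LinearMap.ext fun c => funext fun w => ?_
    simp only [LinearMap.funLeft_apply, Module.End.mul_apply, toAdd_mul]
    congr 1
    abel

/-- The action of Laurent polynomials on `k`-valued configurations. -/
noncomputable def laurentAct : AddMonoidAlgebra k Grid →ₐ[k] Module.End k (Grid → k) :=
  AddMonoidAlgebra.lift k _ Grid (translationHom k)

variable {k}

theorem laurentAct_mon (u : Grid) (c : Grid → k) (w : Grid) :
    laurentAct k (mon k u) c w = c (w - u) := by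
  simp [laurentAct, mon, translationHom, LinearMap.funLeft_apply]

theorem laurentAct_algebraMap (a : k) (c : Grid → k) :
    laurentAct k (algebraMap k _ a) c = a • c := by
  rw [AlgHom.commutes, Module.algebraMap_end_apply]

/-- The ideal of the Laurent polynomials that map the configuration `c` to a constant one. -/
noncomputable def constIdeal (c : Grid → k) : Ideal (AddMonoidAlgebra k Grid) where
  -- Constancy is phrased as being killed by every X^z - 1, so that closure under multiplication
  -- follows from commutativity.
  carrier := {f | ∀ z, laurentAct k ((mon k z - 1) * f) c = 0}
  add_mem' hf hg z := by
    rw [mul_add, map_add, LinearMap.add_apply, hf z, hg z, add_zero]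
  zero_mem' z := by simp
  smul_mem' r f hf z := by
    rw [smul_eq_mul, mul_left_comm, map_mul, Module.End.mul_apply, hf z, map_zero]

theorem mem_constIdeal_iff {c : Grid → k} {f : AddMonoidAlgebra k Grid} :
    f ∈ constIdeal c ↔ ∀ w w', laurentAct k f c w = laurentAct k f c w' := by
  have key : ∀ z w, laurentAct k ((mon k z - 1) * f) c w =
      laurentAct k f c (w - z) - laurentAct k f c w := fun z w => by
    rw [sub_mul, one_mul, map_sub, LinearMap.sub_apply, map_mul, Module.End.mul_apply,
      Pi.sub_apply, laurentAct_mon]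
  constructor
  · intro h w w'
    have := congrFun (h (w' - w)) w'
    rw [key, sub_sub_cancel, Pi.zero_apply] at this
    exact sub_eq_zero.1 this
  · intro h z
    funext w
    rw [key, h (w - z) w, sub_self, Pi.zero_apply]

end Action

/-! ### Dilations of the annihilating relation, by Frobenius. -/

section Dilation

variable (k : Type) [CommRing k]

/-- The polynomial `f_D(X ^ n) - z`. -/
noncomputable def dilatedPolynomial (D : Finset Grid) (z : ℤ) (n : ℕ) : AddMonoidAlgebra k Grid :=
  ∑ u ∈ D, mon k (-(n • u)) - algebraMap k _ (z : k)

variable {k}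

/-- The result of applying `f_D(X ^ n) - z` to an integer configuration. -/
def dilatedSum (x : Grid → ℤ) (D : Finset Grid) (z : ℤ) (n : ℕ) (w : Grid) : ℤ :=
  ∑ u ∈ D, x (w + n • u) - z * x w

theorem laurentAct_dilatedPolynomial (x : Grid → ℤ) (D : Finset Grid) (z : ℤ) (n : ℕ)
    (w : Grid) :
    laurentAct k (dilatedPolynomial k D z n) (fun w => (x w : k)) w = dilatedSum x D z n w := by
  rw [dilatedPolynomial, map_sub, LinearMap.sub_apply, Pi.sub_apply, laurentAct_algebraMap,
    map_sum, LinearMap.sum_apply, Finset.sum_apply, dilatedSum]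
  simp only [laurentAct_mon, sub_neg_eq_add]
  simp

theorem dilatedPolynomial_mem_constIdeal {x : Grid → ℤ} {D : Finset Grid} {z : ℤ} {n : ℕ} :
    dilatedPolynomial k D z n ∈ constIdeal (fun w => (x w : k)) ↔
      ∀ w w', (dilatedSum x D z n w : k) = dilatedSum x D z n w' := by
  simp only [mem_constIdeal_iff, laurentAct_dilatedPolynomial]

theorem dilatedPolynomial_pow_char (p : ℕ) [Fact p.Prime] (D : Finset Grid) (z : ℤ) (n : ℕ) :
    dilatedPolynomial (ZMod p) D z n ^ p = dilatedPolynomial (ZMod p) D z (p * n) := by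
  have : CharP (AddMonoidAlgebra (ZMod p) Grid) p :=
    charP_of_injective_algebraMap (FaithfulSMul.algebraMap_injective (ZMod p) _) p
  rw [dilatedPolynomial, dilatedPolynomial, sub_pow_char, sum_pow_char, ← map_pow, ZMod.pow_card]
  congr 2
  funext u
  rw [← mon_nsmul, smul_neg, mul_smul]

/-- Prime factors of n are adjoined one at a time. The p-th power of the relation modulo p makes
differences of values divisible by p, while their size is at most |D| + |z| ≤ K < p. -/
theorem dilatedSum_const {x : Grid → ℤ} (hx : ∀ w, 0 ≤ x w ∧ x w ≤ 1) {D : Finset Grid} {z : ℤ}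
    {K : ℕ} (hK : D.card + |z| ≤ K)
    (h1 : ∀ w w', dilatedSum x D z 1 w = dilatedSum x D z 1 w') (n : ℕ) (hn0 : n ≠ 0)
    (hn : ∀ p : ℕ, p.Prime → p ∣ n → K < p) (w w' : Grid) :
    dilatedSum x D z n w = dilatedSum x D z n w' := by
  induction n using induction_on_primes generalizing w w' with
  | zero => exact absurd rfl hn0
  | one => exact h1 w w'
  | prime_mul p n hp ih =>
    have : Fact p.Prime := ⟨hp⟩
    have ih' := ih (right_ne_zero_of_mul hn0) fun q hq hqn => hn q hq (hqn.mul_left p)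
    have hmem : dilatedPolynomial (ZMod p) D z n ∈ constIdeal fun w => (x w : ZMod p) :=
      dilatedPolynomial_mem_constIdeal.2 fun w w' => by rw [ih' w w']
    have hmem' := Ideal.pow_mem_of_mem _ hmem p hp.pos
    rw [dilatedPolynomial_pow_char, dilatedPolynomial_mem_constIdeal] at hmem'
    have hdvd : (p : ℤ) ∣ dilatedSum x D z (p * n) w - dilatedSum x D z (p * n) w' := by
      rw [← ZMod.intCast_zmod_eq_zero_iff_dvd, Int.cast_sub, hmem' w w', sub_self]
    have hdiff : ∀ u v, |x u - x v| ≤ 1 := fun u v => by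
      have := hx u; have := hx v; rw [abs_le]; omega
    have hlt : |dilatedSum x D z (p * n) w - dilatedSum x D z (p * n) w'| < p := by
      have hKp : (K : ℤ) < p := by exact_mod_cast hn p hp (dvd_mul_right p n)
      refine lt_of_le_of_lt (le_trans ?_ hK) hKp
      have : dilatedSum x D z (p * n) w - dilatedSum x D z (p * n) w' =
          ∑ u ∈ D, (x (w + (p * n) • u) - x (w' + (p * n) • u)) - z * (x w - x w') := by
        rw [Finset.sum_sub_distrib, dilatedSum, dilatedSum]; ring
      rw [this]
      refine (abs_sub _ _).trans (add_le_add ?_ ?_)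
      · refine (Finset.abs_sum_le_sum_abs _ _).trans ?_
        refine (Finset.sum_le_card_nsmul _ _ 1 fun u _ => hdiff _ _).trans ?_
        simp
      · rw [abs_mul]
        exact mul_le_of_le_one_right (abs_nonneg _) (hdiff _ _)
    exact sub_eq_zero.1 (Int.eq_zero_of_abs_lt_dvd hdvd hlt)

end Dilation

/-! ### Interpolation and bounded-degree relations for coverings. -/

theorem coveringPolynomial_eq (D : Finset Grid) (b a : ℕ) :
    coveringPolynomial D b a = dilatedPolynomial ℂ D ((b : ℤ) - a) 1 := by
  rw [coveringPolynomial, dilatedPolynomial, charPolynomial, single_eq_algebraMap_mul_mon 0,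
    mon_zero, mul_one]
  simp [mon]

/-- Applying the endomorphism X^u ↦ X^(nu) to the expansion of g avoids distinguishing whether 0 ∈
D. -/
theorem dilatedPolynomial_eq_sum (D : Finset Grid) (b a n : ℕ) :
    dilatedPolynomial ℂ D ((b : ℤ) - a) n = ∑ u ∈ (coveringPolynomial D b a).coeff.support,
      algebraMap ℂ Laurent ((coveringPolynomial D b a).coeff u) * mon ℂ (n • u) := by
  set φ : Laurent →ₐ[ℂ] Laurent :=
    AddMonoidAlgebra.mapDomainAlgHom ℂ ℂ (nsmulAddMonoidHom (α := Grid) n)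
  have hφ : ∀ u, φ (mon ℂ u) = mon ℂ (n • u) := fun u => by simp [φ, mon]
  have h := congrArg φ (sum_algebraMap_mul_mon (coveringPolynomial D b a))
  simp only [map_sum, map_mul, AlgHom.commutes, hφ] at h
  rw [h, coveringPolynomial_eq, dilatedPolynomial, dilatedPolynomial, map_sub, map_sum,
    AlgHom.commutes]
  simp only [hφ, one_smul, smul_neg]

/-- Interpolation: if all dilations `g(X ^ n)` with `n ≡ 1` modulo `M` belong to an ideal, so does
the product of the binomials `X ^ (M u₀) - X ^ (M u)`. -/
theorem binomialProduct_mem {g : Laurent} {I : Ideal Laurent} {M : ℕ}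
    (h : ∀ j : ℕ, ∑ u ∈ g.coeff.support,
      algebraMap ℂ Laurent (g.coeff u) * mon ℂ ((1 + j * M) • u) ∈ I)
    {u₀ : Grid} (hu₀ : u₀ ∈ g.coeff.support) : binomialProduct g u₀ M ∈ I := by
  set P : Polynomial Laurent :=
    ∏ u ∈ g.coeff.support.erase u₀, (Polynomial.X - Polynomial.C (mon ℂ (M • u))) with hP
  have heval : ∀ y, P.eval y = ∏ u ∈ g.coeff.support.erase u₀, (y - mon ℂ (M • u)) := fun y => by
    simp [hP, Polynomial.eval_prod]
  -- Weighting the j-th dilation by the j-th coefficient of P gives ∑ g_u X^u P(X^(M u)), where P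
  -- kills every term except u₀.
  have hmem : ∑ j ∈ Finset.range (P.natDegree + 1), P.coeff j * ∑ u ∈ g.coeff.support,
      algebraMap ℂ Laurent (g.coeff u) * mon ℂ ((1 + j * M) • u) ∈ I :=
    Ideal.sum_mem _ fun j _ => Ideal.mul_mem_left _ _ (h j)
  have hsum : ∑ j ∈ Finset.range (P.natDegree + 1), P.coeff j * ∑ u ∈ g.coeff.support,
      algebraMap ℂ Laurent (g.coeff u) * mon ℂ ((1 + j * M) • u) =
      ∑ u ∈ g.coeff.support, algebraMap ℂ Laurent (g.coeff u) * mon ℂ u *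
        P.eval (mon ℂ (M • u)) := by
    simp_rw [Polynomial.eval_eq_sum_range, Finset.mul_sum]
    rw [Finset.sum_comm]
    refine Finset.sum_congr rfl fun u _ => Finset.sum_congr rfl fun j _ => ?_
    rw [add_smul, one_smul, mul_smul, mon_add, mon_nsmul]
    ring
  rw [hsum, Finset.sum_eq_single_of_mem u₀ hu₀, heval] at hmem
  · refine (Ideal.unit_mul_mem_iff_mem I ?_).1 hmem
    refine IsUnit.mul ?_ (isUnit_mon u₀)
    exact (IsUnit.mk0 _ (Finsupp.mem_support_iff.1 hu₀)).map _
  · intro u hu hne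
    have h0 : P.eval (mon ℂ (M • u)) = 0 := by
      rw [heval]
      exact Finset.prod_eq_zero (Finset.mem_erase.2 ⟨hne, hu⟩) (sub_self _)
    rw [h0, mul_zero]

/-- The integer configuration underlying a binary configuration. -/
def intConfig (c : Config (Fin 2)) : Grid → ℤ := fun w => (c w).val

theorem intConfig_eq (c : Config (Fin 2)) (w : Grid) : intConfig c w = if c w = 1 then 1 else 0 := by
  unfold intConfig
  generalize c w = y
  fin_cases y <;> simp

theorem dilatedSum_of_mem_coverings {D : Finset Grid} {b a : ℕ} {c : Config (Fin 2)}
    (hc : c ∈ coverings D b a) (w : Grid) : dilatedSum (intConfig c) D ((b : ℤ) - a) 1 w = a := by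
  have h := hc w
  simp only [dilatedSum, one_smul, intConfig_eq]
  rw [Finset.sum_boole, h]
  split_ifs <;> simp

/-- Bounds for the size of the data of a covering problem. -/
structure SizeBound (D : Finset Grid) (b a K : ℕ) : Prop where
  coord : ∀ u ∈ D, |u.1| ≤ K ∧ |u.2| ≤ K
  card : D.card + b + a ≤ K

theorem support_coveringPolynomial (D : Finset Grid) (b a : ℕ) :
    (coveringPolynomial D b a).coeff.support ⊆ insert 0 (D.image fun u => -u) := by
  classical
  intro w hw
  by_contra hw'
  rw [Finset.mem_insert, Finset.mem_image] at hw'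
  push Not at hw'
  refine Finsupp.mem_support_iff.1 hw ?_
  rw [coveringPolynomial, charPolynomial]
  simp only [AddMonoidAlgebra.coeff_sub, AddMonoidAlgebra.coeff_sum, Finsupp.sub_apply,
    Finsupp.finsetSum_apply, AddMonoidAlgebra.coeff_single]
  rw [Finset.sum_eq_zero, Finsupp.single_eq_of_ne hw'.1, sub_zero]
  intro u hu
  exact Finsupp.single_eq_of_ne (hw'.2 u hu).symm

/-- An explicit bound for the degrees of the one-variable elimination polynomials. -/
def elimDegree (K : ℕ) : ℕ :=
  -- At most K binomials; the exponents M(u₀ - u), M = K!, have coordinates at most V = 2MK, giving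
  -- at most V roots of unity each; every root costs degree 2m with m = 2VK.
  K * (2 * K.factorial * K * (2 * (2 * (2 * K.factorial * K) * K)))

theorem exists_multiset_mem_constIdeal {D : Finset Grid} {b a K : ℕ}
    (hg : ¬ HasLinePolynomialFactor (coveringPolynomial D b a)) (hK : SizeBound D b a K)
    {c : Config (Fin 2)} (hc : c ∈ coverings D b a) (e : Grid) :
    ∃ s : Multiset ℂ, s.card ≤ elimDegree K ∧
      (s.map fun r => mon ℂ e - algebraMap ℂ Laurent r).prod ∈
        constIdeal fun w => (intConfig c w : ℂ) := by
  classical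
  set g := coveringPolynomial D b a with hgdef
  have hg0 : g ≠ 0 := by
    rintro h0
    exact hg ⟨_, isLinePolynomial_mon_sub (v := (1, 0)) (by simp) one_ne_zero, h0 ▸ dvd_zero _⟩
  obtain ⟨u₀, hu₀⟩ : g.coeff.support.Nonempty := by
    rw [Finsupp.support_nonempty_iff]
    simpa using hg0
  have hsupp := support_coveringPolynomial D b a
  rw [← hgdef] at hsupp
  have hcoord : ∀ u ∈ g.coeff.support, |u.1| ≤ K ∧ |u.2| ≤ K := by
    intro u hu
    have := hsupp hu
    rw [Finset.mem_insert, Finset.mem_image] at this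
    rcases this with rfl | ⟨v, hv, rfl⟩
    · simp
    · simpa using hK.coord v hv
  have hcard : (g.coeff.support.erase u₀).card ≤ K := by
    rw [Finset.card_erase_of_mem hu₀]
    have h1 := Finset.card_le_card hsupp
    have h2 := Finset.card_insert_le 0 (D.image fun u => -u)
    have h3 := Finset.card_image_le (s := D) (f := fun u => -u)
    have h4 := hK.card
    omega
  have hz : (D.card : ℤ) + |(b : ℤ) - a| ≤ K := by
    have := hK.card
    have : |(b : ℤ) - a| ≤ b + a := by rw [abs_le]; omega
    omega
  have hdil : ∀ n : ℕ, n ≠ 0 → (∀ p : ℕ, p.Prime → p ∣ n → K < p) →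
      dilatedPolynomial ℂ D ((b : ℤ) - a) n ∈ constIdeal fun w => (intConfig c w : ℂ) := by
    intro n hn0 hn
    refine dilatedPolynomial_mem_constIdeal.2 fun w w' => ?_
    rw [dilatedSum_const (fun w => ?_) hz (fun w w' => ?_) n hn0 hn w w']
    · rw [intConfig_eq]; split_ifs <;> simp
    · rw [dilatedSum_of_mem_coverings hc, dilatedSum_of_mem_coverings hc]
  obtain ⟨s, hs, hmem⟩ := splitElim_binomialProduct hg e (Nat.factorial_ne_zero K) hcoord hu₀ hcard
  refine ⟨s, hs, Ideal.span_le.2 ?_ hmem⟩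
  rintro f (rfl | rfl)
  · rw [hgdef, coveringPolynomial_eq]
    refine hdil 1 one_ne_zero fun p hp hp1 => absurd (Nat.dvd_one.1 hp1) hp.ne_one
  · refine binomialProduct_mem (fun j => ?_) hu₀
    rw [hgdef, ← dilatedPolynomial_eq_sum]
    refine hdil _ (by omega) fun p hp hpd => ?_
    -- A prime p ≤ K divides K!, so it cannot divide 1 + j K!.
    by_contra! hle
    have h1 : p ∣ j * K.factorial := (hp.dvd_factorial.2 hle).mul_left j
    exact hp.ne_one (Nat.dvd_one.1 ((Nat.dvd_add_left h1).1 hpd))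

/-! ### From recurrences to a common period. -/

/-- A bi-infinite binary sequence whose terms are determined by the `d` preceding ones has the
period `(2 ^ d)!`. -/
theorem periodic_of_determined {s : ℤ → Fin 2} {d : ℕ} (hd : 0 < d)
    (h : ∀ i j : ℤ, (∀ k < d, s (i + k) = s (j + k)) → s (i + d) = s (j + d)) (i : ℤ) :
    s (i + (2 ^ d).factorial) = s i := by
  set W : ℤ → Fin d → Fin 2 := fun i k => s (i + (k : ℕ)) with hW
  have hstep : ∀ i j, W i = W j → W (i + 1) = W (j + 1) := by
    intro i j hij
    have hij' : ∀ k < d, s (i + k) = s (j + k) := fun k hk => congrFun hij ⟨k, hk⟩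
    funext ⟨k, hk⟩
    simp only [hW, add_assoc]
    rcases Nat.lt_or_eq_of_le (Nat.succ_le_of_lt hk) with hk' | hk'
    · have := hij' (k + 1) hk'
      push_cast at this
      rwa [add_comm (k : ℤ) 1] at this
    · have := h i j hij'
      rw [← hk'] at this
      push_cast at this
      rwa [add_comm (k : ℤ) 1] at this
  have hsteps : ∀ (m : ℕ) (i j : ℤ), W i = W j → W (i + m) = W (j + m) := by
    intro m
    induction m with
    | zero => intro i j hij; simpa using hij
    | succ m ih =>
      intro i j hij
      have := hstep _ _ (ih i j hij)
      push_cast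
      rwa [← add_assoc, ← add_assoc]
  -- The pigeonhole is applied to windows starting at or to the left of i; pushing the repetition
  -- forward makes it land exactly at i.
  obtain ⟨t, ht0, htd, ht⟩ : ∃ t : ℕ, 0 < t ∧ t ≤ 2 ^ d ∧ W (i + t) = W i := by
    obtain ⟨j, k, hjk, hEq⟩ := Fintype.exists_ne_map_eq_of_card_lt
      (fun j : Fin (2 ^ d + 1) => W (i - (2 ^ d : ℕ) + (j : ℕ))) (by simp)
    wlog hlt : j < k generalizing j k
    · exact this k j hjk.symm hEq.symm (lt_of_le_of_ne (not_lt.1 hlt) hjk.symm)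
    have hk := k.is_lt
    have hlt' : (j : ℕ) < k := hlt
    refine ⟨k - j, by omega, by omega, ?_⟩
    have := hsteps (2 ^ d - j) _ _ hEq.symm
    convert this using 2
    · omega
    · omega
  have hmul : ∀ q : ℕ, W (i + (t * q : ℕ)) = W i := by
    intro q
    induction q with
    | zero => simp
    | succ q ih =>
      rw [← ht, ← hsteps t _ _ ih]
      congr 1
      push_cast
      ring
  obtain ⟨q, hq⟩ := Nat.dvd_factorial ht0 htd
  have := congrFun (hmul q) ⟨0, hd⟩
  rw [← hq] at this
  simpa [hW] using this

theorem laurentAct_aeval_mon (e : Grid) (Q : Polynomial ℂ) (x : Grid → ℂ) (w : Grid) :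
    laurentAct ℂ (Polynomial.aeval (mon ℂ e) Q) x w =
      ∑ i ∈ Finset.range (Q.natDegree + 1), Q.coeff i * x (w - i • e) := by
  rw [Polynomial.aeval_eq_sum_range, map_sum, LinearMap.sum_apply, Finset.sum_apply]
  refine Finset.sum_congr rfl fun i _ => ?_
  rw [map_smul, LinearMap.smul_apply, Pi.smul_apply, ← mon_nsmul, laurentAct_mon, smul_eq_mul]

/-- Comparing the constant value of Q(X^e) c at two cells of a line, equal windows cancel and leave
the leading terms, which have coefficient 1. -/
theorem periodic_of_monic {c : Config (Fin 2)} {e : Grid} {Q : Polynomial ℂ} (hQ : Q.Monic)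
    (hd : 0 < Q.natDegree)
    (h : Polynomial.aeval (mon ℂ e) Q ∈ constIdeal fun w => (intConfig c w : ℂ)) (w : Grid) :
    c (w - (2 ^ Q.natDegree).factorial • e) = c w := by
  rw [mem_constIdeal_iff] at h
  simp only [laurentAct_aeval_mon, Finset.sum_range_succ, hQ.coeff_natDegree, one_mul] at h
  have key := periodic_of_determined (s := fun i : ℤ => c (w - i • e)) hd ?_ 0
  · simpa using key
  intro i j hij
  have h1 := h (w - i • e) (w - j • e)
  have hs : ∀ i : ℤ, ∀ k : ℕ, w - i • e - k • e = w - (i + k) • e := fun i k => by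
    rw [add_smul, natCast_zsmul, sub_sub]
  simp only [hs] at h1
  rw [Finset.sum_congr rfl fun k hk => by
    rw [intConfig, hij k (Finset.mem_range.1 hk), ← intConfig]] at h1
  have h2 := add_left_cancel h1
  simpa [intConfig, Fin.val_inj] using h2

/-- A common period of all coverings, in terms of a bound for the size of the data. -/
def coveringPeriod (K : ℕ) : ℕ :=
  (2 ^ (elimDegree K + 1)).factorial

theorem coverings_periodic {D : Finset Grid} {b a K : ℕ}
    (hg : ¬ HasLinePolynomialFactor (coveringPolynomial D b a)) (hK : SizeBound D b a K)
    {c : Config (Fin 2)} (hc : c ∈ coverings D b a) (e w : Grid) :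
    c (w - coveringPeriod K • e) = c w := by
  obtain ⟨s, hs, hmem⟩ := exists_multiset_mem_constIdeal hg hK hc e
  set P : Polynomial ℂ := (s.map fun r => Polynomial.X - Polynomial.C r).prod with hP
  have hPm : P.Monic := Polynomial.monic_multiset_prod_of_monic _ _ fun r _ =>
    Polynomial.monic_X_sub_C r
  have hPd : P.natDegree = s.card := Polynomial.natDegree_multiset_prod_X_sub_C_eq_card s
  have hPa : Polynomial.aeval (mon ℂ e) P =
      (s.map fun r => mon ℂ e - algebraMap ℂ Laurent r).prod := by
    rw [hP, map_multiset_prod, Multiset.map_map]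
    simp
  -- The power of X pads the degree to a positive value that depends on K only, so that the period
  -- does not depend on c or e.
  have hQm : (Polynomial.X ^ (elimDegree K + 1 - s.card) * P).Monic :=
    (Polynomial.monic_X_pow _).mul hPm
  have hQd : (Polynomial.X ^ (elimDegree K + 1 - s.card) * P).natDegree = elimDegree K + 1 := by
    rw [(Polynomial.monic_X_pow _).natDegree_mul hPm, Polynomial.natDegree_X_pow, hPd]
    omega
  have := periodic_of_monic hQm (by omega) (by
    rw [map_mul, hPa]
    exact Ideal.mul_mem_left _ _ hmem) w
  rwa [hQd] at this

/-! ### Finite type. -/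

/-- The condition at u depends only on the pattern on u + (D ∪ {0}). If it fails there, that pattern
occurs in no covering and is therefore forbidden. -/
theorem isSFT_coverings (D : Finset Grid) (b a : ℕ) : IsSFT (coverings D b a) := by
  classical
  refine ⟨{p | p.1 = insert 0 D ∧ ∀ c ∈ coverings D b a, ¬ Appears p c}, ?_, ?_⟩
  · refine (Set.finite_range (Sigma.mk (β := fun E : Finset Grid => {u : Grid // u ∈ E} → Fin 2)
      (insert 0 D))).subset ?_
    rintro ⟨E, p⟩ ⟨rfl, -⟩
    exact ⟨p, rfl⟩
  · ext c
    constructor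
    · rintro hc p hp ⟨-, h⟩
      exact h c hc hp
    · intro hc u
      by_contra hu
      refine hc ⟨insert 0 D, fun v => c (u + v.1)⟩ ⟨-u, fun v => ?_⟩ ⟨rfl, ?_⟩
      · simp [translateConfig, add_comm]
      · rintro c' hc' ⟨t, ht⟩
        have ht' : ∀ v ∈ insert 0 D, c' (-t + v) = c (u + v) := fun v hv => by
          have := ht ⟨v, hv⟩
          simpa [translateConfig, sub_eq_add_neg, add_comm] using this
        have h0 := ht' 0 (Finset.mem_insert_self _ _)
        rw [add_zero, add_zero] at h0
        refine hu ?_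
        rw [← h0, ← hc' (-t)]
        refine congrArg Finset.card (Finset.filter_congr fun v hv => ?_)
        rw [ht' v (Finset.mem_insert_of_mem hv)]

/-! ### Size bounds and enumeration of torus codes. -/

theorem Int.natAbs_le_encode (z : ℤ) : z.natAbs ≤ Encodable.encode z := by
  rcases z with n | n
  · change n ≤ 2 * n
    omega
  · change n + 1 ≤ 2 * n + 1
    omega

theorem List.encode_le_of_mem {α : Type*} [Encodable α] {x : α} {l : List α} (h : x ∈ l) :
    Encodable.encode x ≤ Encodable.encode l := by
  induction l with
  | nil => simp at h
  | cons y l ih =>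
    rw [Encodable.encode_list_cons]
    rcases List.mem_cons.1 h with rfl | h
    · exact (Nat.left_le_pair _ _).trans (Nat.le_succ _)
    · exact ((ih h).trans (Nat.right_le_pair _ _)).trans (Nat.le_succ _)

/-- A bound for the size of a covering problem. -/
def sizeBound (x : List Grid × ℕ × ℕ) : ℕ :=
  Encodable.encode x.1 + x.2.1 + x.2.2

/-- The code of a list bounds both its length and the codes of its entries, so it serves as a
computable size. -/
theorem sizeBound_spec (l : List Grid) (b a : ℕ) :
    SizeBound l.toFinset b a (sizeBound (l, b, a)) := by
  constructor
  · intro u hu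
    have h1 := List.encode_le_of_mem (List.mem_toFinset.1 hu)
    have h2 : Encodable.encode u = Nat.pair (Encodable.encode u.1) (Encodable.encode u.2) := rfl
    have h3 := Nat.left_le_pair (Encodable.encode u.1) (Encodable.encode u.2)
    have h4 := Nat.right_le_pair (Encodable.encode u.1) (Encodable.encode u.2)
    have h5 := Int.natAbs_le_encode u.1
    have h6 := Int.natAbs_le_encode u.2
    simp only [sizeBound, Int.abs_eq_natAbs]
    omega
  · have h1 := List.toFinset_card_le l
    have h2 := Encodable.length_le_encode l
    simp only [sizeBound]
    omega

/-- All binary words of length `n`. -/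
def allWords (n : ℕ) : List (List (Fin 2)) :=
  Nat.rec [[]] (fun _ L => L.map (List.cons 0) ++ L.map (List.cons 1)) n

theorem mem_allWords {n : ℕ} {w : List (Fin 2)} : w ∈ allWords n ↔ w.length = n := by
  induction n generalizing w with
  | zero => simp [allWords]
  | succ n ih =>
    have h : allWords (n + 1) =
        (allWords n).map (List.cons 0) ++ (allWords n).map (List.cons 1) := rfl
    rw [h, List.mem_append, List.mem_map, List.mem_map]
    constructor
    · rintro (⟨v, hv, rfl⟩ | ⟨v, hv, rfl⟩) <;> simp [ih.1 hv]
    · intro hw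
      obtain _ | ⟨y, v⟩ := w
      · simp at hw
      · have hv := ih.2 (Nat.succ.inj hw)
        fin_cases y
        · exact Or.inl ⟨v, hv, rfl⟩
        · exact Or.inr ⟨v, hv, rfl⟩

/-- The remainder of an integer modulo a natural number. -/
def emodNat (z : ℤ) (N : ℕ) : ℕ := (z % (N : ℤ)).toNat

theorem emodNat_natCast_add {N : ℕ} (hN : 0 < N) (i : ℕ) (z : ℤ) :
    emodNat (i + z) N = (i + emodNat z N) % N := by
  have hN' : (0 : ℤ) < N := by exact_mod_cast hN
  unfold emodNat
  zify
  rw [Int.toNat_of_nonneg (Int.emod_nonneg _ hN'.ne'), Int.toNat_of_nonneg (Int.emod_nonneg _ hN'.ne'),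
    Int.add_emod_emod]

theorem emodNat_lt {N : ℕ} (hN : 0 < N) (z : ℤ) : emodNat z N < N := by
  have hN' : (0 : ℤ) < N := by exact_mod_cast hN
  have := Int.emod_lt_of_pos z hN'
  have := Int.emod_nonneg z hN'.ne'
  unfold emodNat
  omega

theorem emodNat_of_lt {N i : ℕ} (h : i < N) : emodNat i N = i := by
  rw [emodNat, ← Int.natCast_mod, Int.toNat_natCast, Nat.mod_eq_of_lt h]

theorem emodNat_add {N : ℕ} (hN : 0 < N) (y z : ℤ) :
    emodNat (y + z) N = (emodNat y N + emodNat z N) % N := by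
  have hN' : (0 : ℤ) < N := by exact_mod_cast hN
  rw [← emodNat_natCast_add hN, emodNat, emodNat, emodNat,
    Int.toNat_of_nonneg (Int.emod_nonneg _ hN'.ne'), Int.emod_add_emod]

/-- The cell `(i, j)` of the fundamental square of a torus code. -/
def TorusCode.cell (d : TorusCode) (i j : ℕ) : Fin 2 := d.2.getD (i * d.1 + j) 0

theorem TorusCode.toConfig_eq_cell (d : TorusCode) (u : Grid) :
    d.toConfig u = d.cell (emodNat u.1 d.1) (emodNat u.2 d.1) := rfl

/-- The torus code satisfies the covering condition for `x = (D, b, a)`. -/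
def IsCoveringCode (d : TorusCode) (x : List Grid × ℕ × ℕ) : Prop :=
  ∀ i ∈ List.range d.1, ∀ j ∈ List.range d.1,
    -- Duplicates are removed because the list may repeat points of D.
    (x.1.filter fun v => d.cell ((i + emodNat v.1 d.1) % d.1)
      ((j + emodNat v.2 d.1) % d.1) = 1).dedup.length = if d.cell i j = 1 then x.2.1 else x.2.2

instance : DecidableRel IsCoveringCode := fun d x => by
  unfold IsCoveringCode
  infer_instance

theorem isCoveringCode_iff {d : TorusCode} (hd : 0 < d.1) (l : List Grid) (b a : ℕ) :
    IsCoveringCode d (l, b, a) ↔ d.toConfig ∈ coverings l.toFinset b a := by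
  have hcard : ∀ u : Grid, (l.toFinset.filter fun v => d.toConfig (u + v) = 1).card =
      (l.filter fun v => d.cell ((emodNat u.1 d.1 + emodNat v.1 d.1) % d.1)
        ((emodNat u.2 d.1 + emodNat v.2 d.1) % d.1) = 1).dedup.length := by
    intro u
    rw [← List.card_toFinset, List.toFinset_filter]
    congr 1
    ext v
    simp only [Finset.mem_filter, TorusCode.toConfig_eq_cell, Prod.fst_add, Prod.snd_add,
      emodNat_add hd, decide_eq_true_eq]
  constructor
  · intro h u
    rw [hcard, TorusCode.toConfig_eq_cell]
    exact h _ (List.mem_range.2 (emodNat_lt hd _)) _ (List.mem_range.2 (emodNat_lt hd _))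
  · intro h i hi j hj
    have := h ((i : ℤ), (j : ℤ))
    rw [hcard, TorusCode.toConfig_eq_cell] at this
    simpa only [emodNat_of_lt (List.mem_range.1 hi), emodNat_of_lt (List.mem_range.1 hj)] using this

/-- The list of the codes of all coverings. -/
def coveringCodes (x : List Grid × ℕ × ℕ) : List TorusCode :=
  ((allWords (coveringPeriod (sizeBound x) * coveringPeriod (sizeBound x))).map
    (Prod.mk (coveringPeriod (sizeBound x)))).filter fun d => IsCoveringCode d x

theorem coveringPeriod_pos (K : ℕ) : 0 < coveringPeriod K := Nat.factorial_pos _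

theorem mem_coveringCodes {x : List Grid × ℕ × ℕ} {d : TorusCode} :
    d ∈ coveringCodes x ↔ d.1 = coveringPeriod (sizeBound x) ∧ d.Valid ∧ IsCoveringCode d x := by
  simp only [coveringCodes, List.mem_filter, List.mem_map, mem_allWords, decide_eq_true_eq]
  constructor
  · rintro ⟨⟨w, hw, rfl⟩, h⟩
    exact ⟨rfl, ⟨coveringPeriod_pos _, hw⟩, h⟩
  · rintro ⟨h1, ⟨-, h2⟩, h3⟩
    exact ⟨⟨d.2, by rw [h2, h1], Prod.ext h1.symm rfl⟩, h3⟩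

theorem exists_valid_code {c : Config (Fin 2)} {N : ℕ} (hN : 0 < N)
    (hc : ∀ e w : Grid, c (w - N • e) = c w) :
    ∃ d : TorusCode, d.1 = N ∧ d.Valid ∧ c = d.toConfig := by
  refine ⟨(N, (List.range (N * N)).map fun k => c (((k / N : ℕ) : ℤ), ((k % N : ℕ) : ℤ))), rfl,
    ⟨hN, by simp⟩, ?_⟩
  funext u
  have h1 := emodNat_lt hN u.1
  have h2 := emodNat_lt hN u.2
  have hN' : (0 : ℤ) < N := by exact_mod_cast hN
  rw [TorusCode.toConfig_eq_cell, TorusCode.cell]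
  dsimp only
  have hlt : emodNat u.1 N * N + emodNat u.2 N < N * N := by nlinarith
  rw [List.getD_eq_getElem _ _ (by simpa using hlt), List.getElem_map, List.getElem_range,
    Nat.add_div_of_dvd_right (Dvd.intro_left _ rfl), Nat.mul_div_cancel _ hN,
    Nat.div_eq_of_lt h2, add_zero, Nat.mul_add_mod', Nat.mod_eq_of_lt h2, ← hc (u.1 / N, u.2 / N) u]
  congr 1
  ext
  · simp only [emodNat, Prod.fst_sub, Prod.smul_fst]
    rw [nsmul_eq_mul, Int.toNat_of_nonneg (Int.emod_nonneg _ hN'.ne'), Int.emod_def]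
  · simp only [emodNat, Prod.snd_sub, Prod.smul_snd]
    rw [nsmul_eq_mul, Int.toNat_of_nonneg (Int.emod_nonneg _ hN'.ne'), Int.emod_def]

/-- Completeness rests on the common period; soundness only on the check over the fundamental
square. -/
theorem coverings_eq_coveringCodes {l : List Grid} {b a : ℕ}
    (hg : ¬ HasLinePolynomialFactor (coveringPolynomial l.toFinset b a)) :
    coverings l.toFinset b a = {c | ∃ d ∈ coveringCodes (l, b, a), c = d.toConfig} := by
  ext c
  constructor
  · intro hc
    obtain ⟨d, hd, hv, rfl⟩ := exists_valid_code (coveringPeriod_pos _)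
      (coverings_periodic hg (sizeBound_spec l b a) hc)
    exact ⟨d, mem_coveringCodes.2 ⟨hd, hv, (isCoveringCode_iff hv.1 l b a).2 hc⟩, rfl⟩
  · rintro ⟨d, hd, rfl⟩
    obtain ⟨-, hv, h⟩ := mem_coveringCodes.1 hd
    exact (isCoveringCode_iff hv.1 l b a).1 h

/-! ### Primitive recursiveness of the enumeration. -/

section Primrec

open Primrec

theorem primrec₂_pow : Primrec₂ ((· ^ ·) : ℕ → ℕ → ℕ) :=
  Primrec₂.unpaired'.1 Nat.Primrec.pow

theorem primrec_factorial : Primrec Nat.factorial :=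
  (nat_rec₁ (f := fun n y => (n + 1) * y) 1
    (nat_mul.comp (succ.comp fst) snd).to₂).of_eq fun n => by
      induction n with
      | zero => rfl
      | succ n ih => simp only [Nat.factorial_succ, ← ih]

theorem primrec_elimDegree : Primrec elimDegree := by
  have two : Primrec fun _ : ℕ => 2 := Primrec.const 2
  have h : Primrec fun K : ℕ => 2 * K.factorial * K :=
    nat_mul.comp (nat_mul.comp two primrec_factorial) Primrec.id
  exact nat_mul.comp Primrec.id (nat_mul.comp h
    (nat_mul.comp two (nat_mul.comp (nat_mul.comp two h) Primrec.id)))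

theorem primrec_coveringPeriod : Primrec coveringPeriod :=
  primrec_factorial.comp (primrec₂_pow.comp (Primrec.const 2) (succ.comp primrec_elimDegree))

theorem primrec_sizeBound : Primrec sizeBound :=
  nat_add.comp (nat_add.comp (Primrec.encode.comp fst) (fst.comp snd)) (snd.comp snd)

theorem primrec_allWords : Primrec allWords := by
  have h : ∀ y : Fin 2, Primrec fun L : List (List (Fin 2)) => L.map (List.cons y) := fun y =>
    list_map Primrec.id (list_cons.comp (Primrec.const y) snd).to₂
  exact nat_rec₁ _ (list_append.comp ((h 0).comp snd) ((h 1).comp snd)).to₂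

/-- Integers are encoded as n ↦ 2n and -(n+1) ↦ 2n+1, so the remainder can be computed on codes. -/
theorem emodNat_eq_ite (z : ℤ) (N : ℕ) : emodNat z N =
    if Encodable.encode z % 2 = 1 then N - 1 - Encodable.encode z / 2 % N
      else Encodable.encode z / 2 % N := by
  rcases z with n | n
  · have h : Encodable.encode (Int.ofNat n) = 2 * n := rfl
    rw [h, if_neg (by omega), Nat.mul_div_cancel_left _ two_pos]
    rfl
  · have h : Encodable.encode (Int.negSucc n) = 2 * n + 1 := rfl
    rw [h, if_pos (by omega), show (2 * n + 1) / 2 = n by omega, emodNat]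
    rcases Nat.eq_zero_or_pos N with rfl | hN
    -- For N = 0 both sides are 0, thanks to truncation.
    · simp
    · rw [Int.negSucc_emod _ (by exact_mod_cast hN), ← Int.natCast_mod]
      omega

theorem primrec₂_emodNat : Primrec₂ emodNat := by
  have he : Primrec fun p : ℤ × ℕ => Encodable.encode p.1 := Primrec.encode.comp fst
  have hd : Primrec fun p : ℤ × ℕ => Encodable.encode p.1 / 2 % p.2 :=
    nat_mod.comp (nat_div.comp he (Primrec.const 2)) snd
  refine Primrec.of_eq (f := fun p : ℤ × ℕ => _) ?_ fun p => (emodNat_eq_ite p.1 p.2).symm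
  exact Primrec.ite (Primrec.eq.comp (nat_mod.comp he (Primrec.const 2)) (Primrec.const 1))
    (nat_sub.comp (nat_sub.comp snd (Primrec.const 1)) hd) hd

theorem primrec_dedup {α : Type*} [Primcodable α] [DecidableEq α] :
    Primrec (List.dedup : List α → List α) := by
  have hmem : PrimrecPred fun q : List α × α × List α => q.2.1 ∈ q.2.2 :=
    ((PrimrecRel.exists_mem_list Primrec.eq).comp (snd.comp snd) (fst.comp snd)).of_eq
      fun q => by simp
  refine (list_foldr (f := fun l : List α => l) (g := fun _ => [])
    (h := fun _ p => if p.1 ∈ p.2 then p.2 else p.1 :: p.2) Primrec.id (Primrec.const [])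
    (Primrec.ite hmem (snd.comp snd)
      (list_cons.comp (fst.comp snd) (snd.comp snd))).to₂).of_eq fun l => ?_
  induction l with
  | nil => rfl
  | cons y l ih =>
    rw [List.foldr_cons, ih]
    dsimp only
    split_ifs with h
    · rw [List.dedup_cons_of_mem (List.mem_dedup.1 h)]
    · rw [List.dedup_cons_of_notMem fun h' => h (List.mem_dedup.2 h')]

theorem primrec_cell {α : Type*} [Primcodable α] {d : α → TorusCode} {i j : α → ℕ}
    (hd : Primrec d) (hi : Primrec i) (hj : Primrec j) :
    Primrec fun x => (d x).cell (i x) (j x) :=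
  (list_getD 0).comp (snd.comp hd) (nat_add.comp (nat_mul.comp hi (fst.comp hd)) hj)

theorem primrecRel_isCoveringCode : PrimrecRel IsCoveringCode := by
  -- Here p stands for (j, i, d, l, b, a).
  have hcell : PrimrecRel fun (v : Grid) (p : ℕ × ℕ × TorusCode × List Grid × ℕ × ℕ) =>
      p.2.2.1.cell ((p.2.1 + emodNat v.1 p.2.2.1.1) % p.2.2.1.1)
        ((p.1 + emodNat v.2 p.2.2.1.1) % p.2.2.1.1) = 1 := by
    have hd : Primrec fun q : Grid × ℕ × ℕ × TorusCode × List Grid × ℕ × ℕ => q.2.2.2.1 :=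
      fst.comp (snd.comp (snd.comp snd))
    refine Primrec.eq.comp (primrec_cell hd ?_ ?_) (Primrec.const 1)
    · exact nat_mod.comp (nat_add.comp (fst.comp (snd.comp snd))
        (primrec₂_emodNat.comp (fst.comp fst) (fst.comp hd))) (fst.comp hd)
    · exact nat_mod.comp (nat_add.comp (fst.comp snd)
        (primrec₂_emodNat.comp (snd.comp fst) (fst.comp hd))) (fst.comp hd)
  have hbody : PrimrecRel fun (j : ℕ) (p : ℕ × TorusCode × List Grid × ℕ × ℕ) =>
      (p.2.2.1.filter fun v => p.2.1.cell ((p.1 + emodNat v.1 p.2.1.1) % p.2.1.1)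
        ((j + emodNat v.2 p.2.1.1) % p.2.1.1) = 1).dedup.length =
        if p.2.1.cell p.1 j = 1 then p.2.2.2.1 else p.2.2.2.2 := by
    refine Primrec.eq.comp (list_length.comp (primrec_dedup.comp
      (hcell.listFilter.comp (fst.comp (snd.comp (snd.comp snd))) Primrec.id))) ?_
    exact Primrec.ite (Primrec.eq.comp
      (primrec_cell (fst.comp (snd.comp snd)) (fst.comp snd) fst) (Primrec.const 1))
      (fst.comp (snd.comp (snd.comp (snd.comp snd))))
      (snd.comp (snd.comp (snd.comp (snd.comp snd))))
  have hrow := (hbody.forall_mem_list.comp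
    (list_range.comp (fst.comp (fst.comp snd))) Primrec.id :
      PrimrecPred fun p : ℕ × TorusCode × List Grid × ℕ × ℕ => _).primrecRel
  exact hrow.forall_mem_list.comp (list_range.comp (fst.comp fst)) Primrec.id

theorem primrec_coveringCodes : Primrec coveringCodes := by
  have hN : Primrec fun x => coveringPeriod (sizeBound x) :=
    primrec_coveringPeriod.comp primrec_sizeBound
  exact primrecRel_isCoveringCode.listFilter.comp
    (list_map (primrec_allWords.comp (nat_mul.comp hN hN))
      (Primrec₂.pair.comp (hN.comp fst) snd).to₂) Primrec.id

end Primrec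

theorem mainTheorem11 :
    (∀ (D : Finset Grid) (b a : ℕ),
      ¬ HasLinePolynomialFactor (coveringPolynomial D b a) →
        IsSFT (coverings D b a) ∧ (coverings D b a).Finite) ∧
    (∃ construct : List Grid × ℕ × ℕ →. List TorusCode,
      Partrec construct ∧
      ∀ (l : List Grid) (b a : ℕ),
        ¬ HasLinePolynomialFactor (coveringPolynomial l.toFinset b a) →
          ∃ T ∈ construct (l, b, a),
            (∀ d ∈ T, TorusCode.Valid d) ∧
            coverings l.toFinset b a = {c | ∃ d ∈ T, c = TorusCode.toConfig d}) := by
  refine ⟨fun D b a hg => ⟨isSFT_coverings D b a, ?_⟩, fun x => Part.some (coveringCodes x),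
    primrec_coveringCodes.to_comp.partrec, fun l b a hg => ⟨coveringCodes (l, b, a),
      Part.mem_some _, fun d hd => (mem_coveringCodes.1 hd).2.1, coverings_eq_coveringCodes hg⟩⟩
  have h := coverings_eq_coveringCodes (l := D.toList) (b := b) (a := a)
    (by rwa [Finset.toList_toFinset])
  rw [Finset.toList_toFinset] at h
  rw [h]
  refine ((coveringCodes (D.toList, b, a)).toFinset.finite_toSet.image TorusCode.toConfig).subset ?_
  rintro c ⟨d, hd, rfl⟩
  exact ⟨d, by simpa using hd, rfl⟩
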